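/- Let $H$ be a Hilbert space and $U$ a Banach space, both over $\mathbb{K}=\mathbb{R}$ or both over $\mathbb{K}=\mathbb{C}$; let $B:U\to H$ be a bounded linear operator and $\Omega\subseteq U$ a (nonempty) closed convex cone. Let $A$ be a densely defined self-adjoint operator in $H$ that generates a $C_0$-semigroup $(S(t))_{t\ge 0}$ and has a discrete spectrum $\sigma$ tending to $-\infty$: every $\lambda\in\sigma$ is a (necessarily real) eigenvalue of finite multiplicity, and for every $c\in\mathbb{R}$ only finitely many $\lambda\in\sigma$ satisfy $\lambda\ge c$. The equation $\dot x(t)=Ax(t)+Bu(t)$ is called approximately $\Omega$-controllable if for every $x_1\in H$ and $\varepsilon>0$ there are a control $u\in L_2^{\mathrm{loc}}([0,\infty),U)$ with $u(t)\in\Omega$ for almost every $t\ge 0$ and a time $0<t_1<\infty$ such that $\|x_1-x(t_1)\|<\varepsilon$, where $x(t)=\int_0^t S(t-\tau)Bu(\tau)\,d\tau$ is the weak solution with $x(0)=0$. For $\varphi\in H$ let $B^*\varphi\in U^*$ be the functional $u\mapsto\langle Bu,\varphi\rangle$, where the inner product is linear in its first argument, and for $g\in U^*$ write $g\le_\Omega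 0$ if $\operatorname{Re} g(u)\le 0$ for all $u\in\Omega$. Then the equation is approximately $\Omega$-controllable if and only if both of the following hold: (1) $\operatorname{Ker}(\lambda I-A)\cap\operatorname{Ker}B^*=\{0\}$ for every $\lambda\in\sigma$; (2) there is no eigenvector $\varphi\neq 0$ of $A$ (for any eigenvalue, in any normalization) with $B^*\varphi\le_\Omega 0$. -/

import Mathlib

open MeasureTheory Set Filter Topology

noncomputable section

namespace OmegaControl

variable {𝕜 : Type*} [RCLike 𝕜]
variable {H : Type*} [NormedAddCommGroup H] [InnerProductSpace 𝕜 H]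
variable {U : Type*} [NormedAddCommGroup U] [NormedSpace 𝕜 U]

/-- The eigenspace `Ker (z I - A)` of an unbounded operator `A` (contained in its domain). -/
def eigenspace (A : H →ₗ.[𝕜] H) (z : 𝕜) : Submodule 𝕜 H where
  carrier := {x | ∃ h : x ∈ A.domain, A ⟨x, h⟩ = z • x}
  zero_mem' := ⟨A.domain.zero_mem, by
    rw [smul_zero]; exact A.map_zero⟩
  add_mem' := by
    rintro x y ⟨hx, ex⟩ ⟨hy, ey⟩
    refine ⟨A.domain.add_mem hx hy, ?_⟩
    rw [smul_add, ← ex, ← ey]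
    exact A.map_add ⟨x, hx⟩ ⟨y, hy⟩
  smul_mem' := by
    rintro c x ⟨hx, ex⟩
    refine ⟨A.domain.smul_mem c hx, ?_⟩
    rw [smul_comm, ← ex]
    exact A.map_smul c ⟨x, hx⟩

/-- The resolvent set of an unbounded operator: `z I - A : D(A) → H` has a bounded
everywhere defined two-sided inverse. -/
def resolventSet (A : H →ₗ.[𝕜] H) : Set 𝕜 :=
  {z | ∃ R : H →L[𝕜] H,
    (∀ y : H, ∃ h : R y ∈ A.domain, z • R y - A ⟨R y, h⟩ = y) ∧
    (∀ x : A.domain, R (z • (x : H) - A x) = x)}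

/-- The spectrum of an unbounded operator. -/
def spectrum (A : H →ₗ.[𝕜] H) : Set 𝕜 := (resolventSet A)ᶜ

/-- Discrete spectrum tending to `-∞`: every spectral value is an eigenvalue of finite
multiplicity, and every half plane `c ≤ Re z` contains only finitely many spectral values. -/
structure HasDiscreteSpectrumToNegInfty (A : H →ₗ.[𝕜] H) : Prop where
  eigenspace_ne_bot : ∀ z ∈ spectrum A, eigenspace A z ≠ ⊥
  finite_multiplicity : ∀ z ∈ spectrum A, FiniteDimensional 𝕜 (eigenspace A z)
  finite_re_ge : ∀ c : ℝ, {z ∈ spectrum A | c ≤ RCLike.re z}.Finite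

/-- Strongly continuous (`C₀`) semigroups of bounded operators; only the values `S t` with
`0 ≤ t` matter. -/
structure IsC0Semigroup (S : ℝ → H →L[𝕜] H) : Prop where
  map_zero : S 0 = ContinuousLinearMap.id 𝕜 H
  map_add : ∀ s t : ℝ, 0 ≤ s → 0 ≤ t → S (s + t) = (S s).comp (S t)
  continuousOn : ∀ x : H, ContinuousOn (fun t => S t x) (Ici 0)

/-- `A` is the infinitesimal generator of `S`: `x ∈ D(A)` and `A x = y` if and only if
`(S t x - x) / t → y` as `t → 0+`. -/
def IsGenerator (A : H →ₗ.[𝕜] H) (S : ℝ → H →L[𝕜] H) : Prop :=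
  ∀ x y : H, (∃ h : x ∈ A.domain, A ⟨x, h⟩ = y) ↔
    Tendsto (fun t : ℝ => ((t : 𝕜)⁻¹) • (S t x - x)) (𝓝[>] 0) (𝓝 y)

/-- The adjoint `B* : H → U*` of a bounded operator `B : U → H`, where `H` is identified with
its dual by the Riesz isomorphism (which is conjugate linear):
`(B* φ) u = ⟪φ, B u⟫`, linear in `u`. -/
def adj (B : U →L[𝕜] H) : H →L⋆[𝕜] StrongDual 𝕜 U :=
  ((ContinuousLinearMap.compL 𝕜 U H 𝕜).flip B).comp (innerSL 𝕜)

theorem adj_apply (B : U →L[𝕜] H) (φ : H) (u : U) : adj B φ u = inner 𝕜 φ (B u) := rfl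

/-- The weak solution at time `t` of `x' = A x + B u`, `x(0) = x₀`, given by the variation of
parameters formula. -/
def solution [NormedSpace ℝ H] (S : ℝ → H →L[𝕜] H) (B : U →L[𝕜] H) (x₀ : H) (u : ℝ → U)
    (t : ℝ) : H :=
  S t x₀ + ∫ τ in (0 : ℝ)..t, S (t - τ) (B (u τ))

variable [NormedSpace ℝ U]

/-- `g₁ ≤_Ω g₂`: `(u, g₁) ≤ (u, g₂)` for all `u ∈ Ω`; over the complex field the real parts are
compared. -/
def LeOn (Ω : ProperCone ℝ U) (g₁ g₂ : StrongDual 𝕜 U) : Prop :=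
  ∀ u ∈ Ω, RCLike.re (g₁ u) ≤ RCLike.re (g₂ u)

/-- Admissible controls: `u ∈ L₂^loc([0, ∞), Ω)`. -/
structure IsAdmissible (Ω : ProperCone ℝ U) (u : ℝ → U) : Prop where
  memLp : ∀ T : ℝ, MemLp u 2 (volume.restrict (Icc 0 T))
  mem : ∀ᵐ t ∂(volume.restrict (Ici (0 : ℝ))), u t ∈ Ω

/-- Approximate `Ω`-controllability of `x' = A x + B u`, where `A` generates `S`: every state is
approximated by endpoints of solutions that start at `0` and have `Ω`-valued controls. -/
def ApproxControllable [NormedSpace ℝ H] (S : ℝ → H →L[𝕜] H) (B : U →L[𝕜] H)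
    (Ω : ProperCone ℝ U) : Prop :=
  ∀ x₁ : H, ∀ ε : ℝ, 0 < ε → ∃ u : ℝ → U, IsAdmissible Ω u ∧
    ∃ t₁ : ℝ, 0 < t₁ ∧ ‖x₁ - solution S B 0 u t₁‖ < ε

end OmegaControl

end

/-! Sufficiency is a separation argument followed by a large-time limit. If the system is not
approximately controllable, Hahn–Banach gives `φ ≠ 0` with `Re ⟪φ, S(t)Bu⟫ ≤ 0` for all `t > 0` and
`u ∈ Ω`. Expand `φ` in eigenvectors of `A` and let `l₀` be the largest eigenvalue with a nonzero
component `v`. Then `exp(-l₀ t) ⟪φ, S(t)y⟫ → ⟪v, y⟫`, so the inequality survives for `v` at `y =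
Bu`, and `v` violates (2) (`exists_dominant_eigenvector`).

Necessity: for an eigenvector `φ` violating (2), `⟪φ, S(t)Bu⟫` is a positive multiple of `⟪φ, Bu⟫`,
so every reachable state lies in a half-space that stays at distance `‖φ‖` from `φ`. Condition (1)
is a consequence of (2).

The expansion needs the eigenvectors to be total. A resolvent `R` at a real point is bounded and
symmetric; on the orthogonal complement of all eigenspaces it has no nonzero eigenvalue, and its
nonzero approximate spectrum is isolated. `eq_zero_of_isolated_of_no_eigenvalue` makes it vanish
there, and `R` is injective. -/

noncomputable section

namespace OmegaControl

/-! ### Bounded symmetric operators with isolated approximate spectrum -/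

section BoundedSymmetric

variable {𝕜 : Type*} [RCLike 𝕜]
variable {E : Type*} [NormedAddCommGroup E] [InnerProductSpace 𝕜 E]

/-- The operator is bounded below in norm by a positive constant. -/
def BoundedBelow (T : E →L[𝕜] E) : Prop := ∃ c : ℝ, 0 < c ∧ ∀ x, c * ‖x‖ ≤ ‖T x‖

/-- The operator `T - r I`, for a real number `r`. -/
def shift (T : E →L[𝕜] E) (r : ℝ) : E →L[𝕜] E := T - (r : 𝕜) • ContinuousLinearMap.id 𝕜 E

theorem shift_apply (T : E →L[𝕜] E) (r : ℝ) (x : E) : shift T r x = T x - (r : 𝕜) • x := rfl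

theorem shift_shift (T : E →L[𝕜] E) (r s : ℝ) : shift (shift T r) s = shift T (r + s) := by
  ext x
  simp only [shift_apply, RCLike.ofReal_add, add_smul]
  abel

theorem isSymmetric_shift {T : E →L[𝕜] E} (hT : (T : E →ₗ[𝕜] E).IsSymmetric) (r : ℝ) :
    (shift T r : E →ₗ[𝕜] E).IsSymmetric := by
  intro x y
  have h := hT x y
  simp only [ContinuousLinearMap.coe_coe] at h ⊢
  simp only [shift_apply, inner_sub_left, inner_sub_right, inner_smul_left, inner_smul_right,
    RCLike.conj_ofReal, h]

theorem BoundedBelow.comp {S T : E →L[𝕜] E} (hS : BoundedBelow S) (hT : BoundedBelow T) :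
    BoundedBelow (S.comp T) := by
  obtain ⟨c, hc, h⟩ := hS
  obtain ⟨d, hd, h'⟩ := hT
  refine ⟨c * d, by positivity, fun x => ?_⟩
  calc c * d * ‖x‖ = c * (d * ‖x‖) := by ring
    _ ≤ c * ‖T x‖ := by gcongr; exact h' x
    _ ≤ _ := h _

theorem BoundedBelow.neg {S : E →L[𝕜] E} (hS : BoundedBelow S) : BoundedBelow (-S) := by
  obtain ⟨c, hc, h⟩ := hS
  exact ⟨c, hc, fun x => by simpa using h x⟩

/-- A positive symmetric operator that is bounded below in norm is coercive. -/
theorem coercive_of_boundedBelow {P : E →L[𝕜] E} (hP : (P : E →ₗ[𝕜] E).IsSymmetric)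
    (hpos : ∀ x, 0 ≤ RCLike.re (inner 𝕜 (P x) x)) (hb : BoundedBelow P) :
    ∃ c : ℝ, 0 < c ∧ ∀ x, c * ‖x‖ ^ 2 ≤ RCLike.re (inner 𝕜 (P x) x) := by
  obtain ⟨c, hc, h⟩ := hb
  set C : ℝ := ‖P‖ + 1 with hC
  have hC0 : 0 < C := by positivity
  refine ⟨c ^ 2 / C, by positivity, fun x => ?_⟩
  -- Positivity at this vector, with `⟪PPx, Px⟫ ≤ C‖Px‖²`, gives `⟪Px, x⟫ ≥ C⁻¹‖Px‖²`. The summand 1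
  -- in `C` keeps it nonzero when `P = 0`.
  have h1 := hpos (x - ((C⁻¹ : ℝ) : 𝕜) • P x)
  have h2 : RCLike.re (inner 𝕜 (P (P x)) (P x)) ≤ C * ‖P x‖ ^ 2 := by
    calc RCLike.re (inner 𝕜 (P (P x)) (P x)) ≤ ‖P (P x)‖ * ‖P x‖ := re_inner_le_norm _ _
      _ ≤ (‖P‖ * ‖P x‖) * ‖P x‖ := by gcongr; exact P.le_opNorm _
      _ ≤ (C * ‖P x‖) * ‖P x‖ := by gcongr; linarith
      _ = _ := by ring
  have h3 : inner 𝕜 (P (P x)) x = inner 𝕜 (P x) (P x) := hP (P x) x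
  have h4 : RCLike.re (inner 𝕜 (P x) (P x)) = ‖P x‖ ^ 2 := by
    rw [inner_self_eq_norm_sq]
  simp only [map_sub, map_smul, inner_sub_left, inner_sub_right, inner_smul_left,
    inner_smul_right, RCLike.conj_ofReal, RCLike.re_ofReal_mul, h3, h4] at h1
  have h5 : C⁻¹ * (C⁻¹ * RCLike.re (inner 𝕜 (P (P x)) (P x))) ≤ C⁻¹ * ‖P x‖ ^ 2 := by
    calc C⁻¹ * (C⁻¹ * RCLike.re (inner 𝕜 (P (P x)) (P x))) ≤ C⁻¹ * (C⁻¹ * (C * ‖P x‖ ^ 2)) := by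
          gcongr
      _ = _ := by field_simp
  have h6 : (c * ‖x‖) ^ 2 ≤ ‖P x‖ ^ 2 := by gcongr; exact h x
  calc c ^ 2 / C * ‖x‖ ^ 2 = C⁻¹ * (c * ‖x‖) ^ 2 := by field_simp
    _ ≤ C⁻¹ * ‖P x‖ ^ 2 := by gcongr
    _ ≤ _ := by linarith

theorem shift_comp_shift_neg (W : E →L[𝕜] E) (m : ℝ) :
    (shift W m).comp (shift W (-m)) = shift (W.comp W) (m ^ 2) := by
  ext x
  simp only [shift_apply, ContinuousLinearMap.comp_apply, map_smul, RCLike.ofReal_neg,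
    RCLike.ofReal_mul, map_sub, sq]
  module

theorem isSymmetric_comp_self {W : E →L[𝕜] E} (hW : (W : E →ₗ[𝕜] E).IsSymmetric) :
    (W.comp W : E →ₗ[𝕜] E).IsSymmetric := fun x y => (hW (W x) y).trans (hW x (W y))

theorem re_inner_shift_comp_self {W : E →L[𝕜] E} (hW : (W : E →ₗ[𝕜] E).IsSymmetric) (r : ℝ)
    (x : E) : RCLike.re (inner 𝕜 (shift (W.comp W) r x) x) = ‖W x‖ ^ 2 - r * ‖x‖ ^ 2 := by
  have h : inner 𝕜 (W (W x)) x = inner 𝕜 (W x) (W x) := hW (W x) x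
  simp only [shift_apply, ContinuousLinearMap.comp_apply, inner_sub_left, inner_smul_left,
    RCLike.conj_ofReal, map_sub, RCLike.re_ofReal_mul, h, inner_self_eq_norm_sq]

/-- `W² - m² = (W - m)(W + m)` is positive and bounded below, hence coercive: a norm bound at a
level `m` with `±m` outside the approximate spectrum is never sharp. -/
theorem exists_lt_norm_sq_of_boundedBelow {W : E →L[𝕜] E} (hW : (W : E →ₗ[𝕜] E).IsSymmetric)
    {m : ℝ} (h₁ : BoundedBelow (shift W m)) (h₂ : BoundedBelow (shift W (-m)))
    (h : ∀ x, m ^ 2 * ‖x‖ ^ 2 ≤ ‖W x‖ ^ 2) :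
    ∃ c : ℝ, 0 < c ∧ ∀ x, (m ^ 2 + c) * ‖x‖ ^ 2 ≤ ‖W x‖ ^ 2 := by
  have hb := h₁.comp h₂
  rw [shift_comp_shift_neg] at hb
  obtain ⟨c, hc, h'⟩ := coercive_of_boundedBelow
    (isSymmetric_shift (isSymmetric_comp_self hW) (m ^ 2))
    (fun x => by rw [re_inner_shift_comp_self hW]; linarith [h x]) hb
  refine ⟨c, hc, fun x => ?_⟩
  have := h' x
  rw [re_inner_shift_comp_self hW] at this
  linarith

theorem exists_norm_sq_lt_of_boundedBelow {W : E →L[𝕜] E} (hW : (W : E →ₗ[𝕜] E).IsSymmetric)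
    {m : ℝ} (h₁ : BoundedBelow (shift W m)) (h₂ : BoundedBelow (shift W (-m)))
    (h : ∀ x, ‖W x‖ ^ 2 ≤ m ^ 2 * ‖x‖ ^ 2) :
    ∃ c : ℝ, 0 < c ∧ ∀ x, ‖W x‖ ^ 2 ≤ (m ^ 2 - c) * ‖x‖ ^ 2 := by
  have hb := (h₁.comp h₂).neg
  rw [shift_comp_shift_neg] at hb
  have hs := isSymmetric_shift (isSymmetric_comp_self hW) (m ^ 2)
  obtain ⟨c, hc, h'⟩ := coercive_of_boundedBelow (P := -shift (W.comp W) (m ^ 2))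
    (fun x y => by
      have := hs x y
      simp only [ContinuousLinearMap.coe_coe] at this
      simp [this])
    (fun x => by
      simp only [neg_apply, inner_neg_left, map_neg,
        re_inner_shift_comp_self hW]
      linarith [h x]) hb
  refine ⟨c, hc, fun x => ?_⟩
  have := h' x
  simp only [neg_apply, inner_neg_left, map_neg,
        re_inner_shift_comp_self hW] at this
  linarith

/-- If `N` is symmetric and `N - z` is bounded below for all real `z` with `0 < |z| < δ`, then
`N` is bounded below by `δ` on its range. -/
theorem boundedBelow_on_range_of_gap {N : E →L[𝕜] E} (hN : (N : E →ₗ[𝕜] E).IsSymmetric)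
    {δ : ℝ} (hδ : 0 < δ) (h : ∀ z : ℝ, 0 < |z| → |z| < δ → BoundedBelow (shift N z)) (x : E) :
    δ * ‖N x‖ ≤ ‖N (N x)‖ := by
  have hQ := isSymmetric_comp_self hN
  set Q : E →L[𝕜] E := N.comp N with hQdef
  have hQb : ∀ z : ℝ, 0 < z → z < δ ^ 2 → BoundedBelow (shift Q z) := by
    intro z hz hzδ
    have hs : 0 < √z := Real.sqrt_pos.2 hz
    have hsδ : √z < δ := by rwa [Real.sqrt_lt' hδ]
    have h1 := h (√z) (by rwa [abs_of_pos hs]) (by rwa [abs_of_pos hs])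
    have h2 := h (-√z) (by rwa [abs_neg, abs_of_pos hs]) (by rwa [abs_neg, abs_of_pos hs])
    have h3 := h1.comp h2
    rwa [shift_comp_shift_neg, Real.sq_sqrt hz.le] at h3
  -- The midpoint of the gap `(0, δ²)` of `Q = N²`; thus `W - m` is bounded below whenever `|m| <
  -- z₀`.
  set z₀ : ℝ := δ ^ 2 / 2 with hz₀
  have hz₀pos : 0 < z₀ := by positivity
  have hz₀lt : z₀ + z₀ = δ ^ 2 := by ring
  set W := shift Q z₀ with hWdef
  have hW : (W : E →ₗ[𝕜] E).IsSymmetric := isSymmetric_shift hQ z₀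
  have key : ∀ x, z₀ * ‖x‖ ≤ ‖W x‖ := by
    -- Continuity argument: take the best lower bound `m ≤ z₀` for `W`. If `m < z₀`, then `±m` lie
    -- in the gap and the bound can be improved.
    obtain ⟨m, ⟨⟨hm0, hmz⟩, hm⟩, hmax⟩ :=
      (isCompact_Icc.inter_right (isClosed_iInter fun x : E =>
        isClosed_le (continuous_id.mul continuous_const) continuous_const) :
        IsCompact (Icc 0 z₀ ∩ ⋂ x : E, {m : ℝ | id m * ‖x‖ ≤ ‖W x‖})).exists_isGreatest
        ⟨0, ⟨le_rfl, hz₀pos.le⟩, by simp⟩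
    simp only [mem_iInter, mem_ofPred_eq, id] at hm
    rcases hmz.eq_or_lt with rfl | hlt
    · exact hm
    exfalso
    have hmpos : 0 < m := by
      obtain ⟨c, hc, hcW⟩ := hQb z₀ hz₀pos (by linarith)
      refine (lt_min hc hz₀pos).trans_le (hmax ⟨⟨(lt_min hc hz₀pos).le, min_le_right _ _⟩, ?_⟩)
      simp only [mem_iInter, mem_ofPred_eq, id]
      exact fun x => le_trans (by gcongr; exact min_le_left _ _) (hcW x)
    obtain ⟨c, hc, hcW⟩ := exists_lt_norm_sq_of_boundedBelow hW (m := m)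
      (by rw [hWdef, shift_shift]; exact hQb _ (by linarith) (by linarith))
      (by rw [hWdef, shift_shift]; exact hQb _ (by linarith) (by linarith))
      (fun x => by rw [← mul_pow]; gcongr; exact hm x)
    have hlt' : m < min z₀ (√(m ^ 2 + c)) :=
      lt_min hlt (Real.lt_sqrt_of_sq_lt (by linarith))
    refine absurd hlt' (not_lt.2 (hmax ⟨⟨(hm0.trans_lt hlt').le, min_le_left _ _⟩, ?_⟩))
    simp only [mem_iInter, mem_ofPred_eq, id]
    intro x
    refine le_trans (mul_le_mul_of_nonneg_right (min_le_right _ _) (norm_nonneg x)) ?_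
    refine le_of_sq_le_sq ?_ (norm_nonneg _)
    rw [mul_pow, Real.sq_sqrt (by positivity)]
    exact hcW x
  have h1 : (z₀ * ‖x‖) ^ 2 ≤ ‖W x‖ ^ 2 := by gcongr; exact key x
  -- The terms `(z₀‖x‖)²` cancel against the lower bound, leaving `‖N²x‖² ≥ 2z₀‖Nx‖² = δ²‖Nx‖²`.
  have h2 : ‖W x‖ ^ 2 = ‖Q x‖ ^ 2 - 2 * (z₀ * ‖N x‖ ^ 2) + (z₀ * ‖x‖) ^ 2 := by
    have h3 : inner 𝕜 (N (N x)) x = inner 𝕜 (N x) (N x) := hN (N x) x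
    rw [hWdef, shift_apply, @norm_sub_sq 𝕜, inner_smul_right, RCLike.re_ofReal_mul, hQdef,
      ContinuousLinearMap.comp_apply, h3, inner_self_eq_norm_sq, norm_smul, RCLike.norm_ofReal,
      abs_of_pos hz₀pos]
  refine le_of_sq_le_sq ?_ (norm_nonneg _)
  change _ ≤ ‖Q x‖ ^ 2
  rw [mul_pow, ← hz₀lt]
  linarith

/-- A symmetric operator without nonzero real eigenvalues, such that each nonzero real `r` has a
punctured neighbourhood of numbers `z` for which `T - z` is bounded below, vanishes. -/
theorem eq_zero_of_isolated_of_no_eigenvalue [CompleteSpace E] {T : E →L[𝕜] E}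
    (hT : (T : E →ₗ[𝕜] E).IsSymmetric)
    (hiso : ∀ r : ℝ, r ≠ 0 → ∀ᶠ z in 𝓝[≠] r, BoundedBelow (shift T z))
    (heig : ∀ r : ℝ, r ≠ 0 → ∀ x, T x = (r : 𝕜) • x → x = 0) : T = 0 := by
  by_contra hT0
  have hb : ∀ r : ℝ, r ≠ 0 → BoundedBelow (shift T r) := by
    intro r hr
    obtain ⟨δ, hδ, hz⟩ := Metric.mem_nhdsWithin_iff.1 (hiso r hr)
    have hN := isSymmetric_shift hT r
    set N := shift T r with hNdef
    have hgap := boundedBelow_on_range_of_gap hN hδ (fun z hz0 hzδ => by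
      rw [hNdef, shift_shift]
      refine hz ⟨?_, ?_⟩
      · simpa [Real.dist_eq] using hzδ
      · simpa using abs_pos.1 hz0)
    -- By symmetry the orthogonal complement of the range lies in the kernel, which is trivial
    -- without eigenvalues. The bound on the range then extends to the whole space.
    have hdense : DenseRange N := by
      have h1 : (LinearMap.range (N : E →ₗ[𝕜] E))ᗮ = ⊥ := by
        rw [eq_bot_iff]
        intro y hy
        rw [Submodule.mem_orthogonal] at hy
        have h2 : N y = 0 := by
          rw [← inner_self_eq_zero (𝕜 := 𝕜)]
          exact (hN (N y) y).symm.trans (hy _ ⟨N y, rfl⟩)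
        rw [hNdef, shift_apply, sub_eq_zero] at h2
        simpa using heig r hr y h2
      have h3 := (Submodule.topologicalClosure_eq_top_iff).2 h1
      exact Submodule.dense_iff_topologicalClosure_eq_top.2 h3
    refine ⟨δ, hδ, fun y => ?_⟩
    refine hdense.induction_on (p := fun y => δ * ‖y‖ ≤ ‖N y‖) y ?_ hgap
    exact isClosed_le (by fun_prop) (by fun_prop)
  -- Now `±‖T‖` are outside the approximate spectrum, so the operator norm bound could be lowered, a
  -- contradiction.
  have hpos : 0 < ‖T‖ := norm_pos_iff.2 hT0
  obtain ⟨c, hc, h⟩ := exists_norm_sq_lt_of_boundedBelow hT (m := ‖T‖) (hb _ hpos.ne')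
    (hb _ (neg_ne_zero.2 hpos.ne'))
    (fun x => by rw [← mul_pow]; gcongr; exact T.le_opNorm x)
  have h1 : ‖T‖ ≤ √(max (‖T‖ ^ 2 - c) 0) := by
    refine T.opNorm_le_bound (Real.sqrt_nonneg _) fun x => ?_
    refine le_of_sq_le_sq ?_ (by positivity)
    rw [mul_pow, Real.sq_sqrt (le_max_right _ _)]
    exact (h x).trans (by gcongr; exact le_max_left _ _)
  have h2 := Real.le_sqrt' hpos |>.1 h1
  rcases le_max_iff.1 h2 with h3 | h3
  · linarith
  · nlinarith

end BoundedSymmetric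

/-! ### Totality of the eigenvectors -/

section Spectral

variable {𝕜 : Type*} [RCLike 𝕜]
variable {H : Type*} [NormedAddCommGroup H] [InnerProductSpace 𝕜 H]
variable {A : H →ₗ.[𝕜] H}

theorem mem_spectrum_of_mem_eigenspace {z : 𝕜} {x : H} (hx : x ∈ eigenspace A z)
    (hx0 : x ≠ 0) : z ∈ spectrum A := by
  rintro ⟨R, -, hR⟩
  obtain ⟨h, e⟩ := hx
  have := hR ⟨x, h⟩
  rw [e, sub_self, map_zero] at this
  exact hx0 this.symm

theorem exists_resolvent_real (hσ : HasDiscreteSpectrumToNegInfty A) :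
    ∃ μ : ℝ, (∀ z ∈ spectrum A, RCLike.re z < μ) ∧ (μ : 𝕜) ∈ resolventSet A := by
  obtain ⟨b, hb⟩ := ((hσ.finite_re_ge 0).image (fun z => (RCLike.re z : ℝ))).bddAbove
  have h : ∀ z ∈ spectrum A, RCLike.re z < max b 0 + 1 := by
    intro z hz
    rcases le_or_gt 0 (RCLike.re z) with h0 | h0
    · have := hb ⟨z, ⟨hz, h0⟩, rfl⟩
      simp only at this
      linarith [le_max_left b 0]
    · linarith [le_max_right b 0]
  refine ⟨max b 0 + 1, h, ?_⟩
  by_contra hn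
  have := h _ hn
  rw [RCLike.ofReal_re] at this
  exact lt_irrefl _ this

theorem smul_resolvent_apply_of_mem_eigenspace {μ : ℝ} {R : H →L[𝕜] H}
    (hR : ∀ x : A.domain, R ((μ : 𝕜) • (x : H) - A x) = x)
    {z : 𝕜} {x : H} (hx : x ∈ eigenspace A z) : ((μ : 𝕜) - z) • R x = x := by
  obtain ⟨h, e⟩ := hx
  have := hR ⟨x, h⟩
  rwa [e, ← sub_smul, map_smul] at this

/-- Since `(μ - r⁻¹ - A)R = -r⁻¹(R - r)`, the resolvent `Q` at `μ - r⁻¹` yields an explicit left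
inverse `-K` of `R - r`. -/
theorem boundedBelow_shift_resolvent {μ : ℝ} {R : H →L[𝕜] H}
    (hR : ∀ y : H, ∃ h : R y ∈ A.domain, (μ : 𝕜) • R y - A ⟨R y, h⟩ = y)
    {r : ℝ} (hr : r ≠ 0) (hres : ((μ - r⁻¹ : ℝ) : 𝕜) ∈ resolventSet A) :
    BoundedBelow (shift R r) := by
  obtain ⟨Q, -, hQ⟩ := hres
  have hr' : (r : 𝕜) ≠ 0 := by exact_mod_cast hr
  set K : H →L[𝕜] H := (r⁻¹ : 𝕜) • (ContinuousLinearMap.id 𝕜 H + (r⁻¹ : 𝕜) • Q) with hK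
  have key : ∀ x, K (shift R r x) = -x := by
    intro x
    obtain ⟨hx, ex⟩ := hR x
    have h1 := hQ ⟨R x, hx⟩
    have h2 : ((μ - r⁻¹ : ℝ) : 𝕜) • R x - A ⟨R x, hx⟩ = -((r⁻¹ : 𝕜) • shift R r x) := by
      rw [sub_eq_iff_eq_add] at ex
      rw [shift_apply, smul_sub, smul_smul, inv_mul_cancel₀ hr', one_smul, RCLike.ofReal_sub,
        RCLike.ofReal_inv, sub_smul]
      rw [ex]
      abel
    simp only at h1
    rw [h2, map_neg, map_smul, neg_eq_iff_eq_neg] at h1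
    rw [hK, smul_apply, add_apply, smul_apply, h1, shift_apply,
      ContinuousLinearMap.id_apply, ← sub_eq_add_neg, sub_sub_cancel_left, smul_neg, smul_smul,
      inv_mul_cancel₀ hr', one_smul]
  refine ⟨(‖K‖ + 1)⁻¹, by positivity, fun x => ?_⟩
  rw [inv_mul_le_iff₀ (by positivity), ← norm_neg x, ← key x]
  exact (K.le_opNorm _).trans (by gcongr; linarith)

theorem mem_eigenspace_of_resolvent_eq {μ : ℝ} {R : H →L[𝕜] H}
    (hR : ∀ y : H, ∃ h : R y ∈ A.domain, (μ : 𝕜) • R y - A ⟨R y, h⟩ = y)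
    {r : ℝ} (hr : r ≠ 0) {x : H} (hx : R x = (r : 𝕜) • x) :
    x ∈ eigenspace A ((μ - r⁻¹ : ℝ) : 𝕜) := by
  have hr' : (r : 𝕜) ≠ 0 := by exact_mod_cast hr
  have hmem : R x ∈ eigenspace A ((μ - r⁻¹ : ℝ) : 𝕜) := by
    obtain ⟨h, e⟩ := hR x
    refine ⟨h, ?_⟩
    rw [RCLike.ofReal_sub, sub_smul, RCLike.ofReal_inv]
    nth_rw 3 [hx]
    rw [smul_smul, inv_mul_cancel₀ hr', one_smul, eq_sub_iff_add_eq]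
    exact (sub_eq_iff_eq_add'.1 e).symm
  have := (eigenspace A ((μ - r⁻¹ : ℝ) : 𝕜)).smul_mem (r : 𝕜)⁻¹ hmem
  rwa [hx, smul_smul, inv_mul_cancel₀ hr', one_smul] at this

/-- Near `r` the points `μ - z⁻¹` stay in a right half-line, which holds finitely many spectral
values, and `z ↦ μ - z⁻¹` is injective. -/
theorem eventually_boundedBelow_shift_resolvent {μ : ℝ} {R : H →L[𝕜] H}
    (hσ : HasDiscreteSpectrumToNegInfty A)
    (hR : ∀ y : H, ∃ h : R y ∈ A.domain, (μ : 𝕜) • R y - A ⟨R y, h⟩ = y)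
    {r : ℝ} (hr : r ≠ 0) : ∀ᶠ z in 𝓝[≠] r, BoundedBelow (shift R z) := by
  have hcont : ContinuousAt (fun z : ℝ => μ - z⁻¹) r := by fun_prop (disch := exact hr)
  have h1 : ∀ᶠ z in 𝓝[≠] r, (μ - r⁻¹) - 1 < μ - z⁻¹ :=
    (hcont.eventually (lt_mem_nhds (by linarith))).filter_mono nhdsWithin_le_nhds
  have h2 : ∀ᶠ z in 𝓝[≠] r, z ≠ 0 :=
    (eventually_ne_nhds hr).filter_mono nhdsWithin_le_nhds
  have hinj : Function.Injective (fun z : ℝ => ((μ - z⁻¹ : ℝ) : 𝕜)) := by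
    intro a b hab
    have := RCLike.ofReal_injective (K := 𝕜) hab
    simpa using this
  have hfin := (hσ.finite_re_ge (μ - r⁻¹ - 1)).preimage hinj.injOn
  have h3 := (hfin.sdiff (t := {r})).isClosed.isOpen_compl.mem_nhds (x := r) (by simp)
  filter_upwards [h1, h2, nhdsWithin_le_nhds h3, self_mem_nhdsWithin] with z hz1 hz2 hz3 hz4
  refine boundedBelow_shift_resolvent hR hz2 ?_
  by_contra hn
  exact hz3 ⟨⟨hn, by rw [RCLike.ofReal_re]; exact hz1.le⟩, hz4⟩

variable [CompleteSpace H]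

theorem inner_apply_comm (hA : IsSelfAdjoint A) (x y : A.domain) :
    inner 𝕜 (A x) (y : H) = inner 𝕜 (x : H) (A y) := by
  have h := LinearPMap.adjoint_isFormalAdjoint hA.dense_domain
  rw [LinearPMap.isSelfAdjoint_def.1 hA] at h
  exact h x y

theorem ofReal_re_eq_of_mem_eigenspace (hA : IsSelfAdjoint A) {z : 𝕜} {x : H}
    (hx : x ∈ eigenspace A z) (hx0 : x ≠ 0) : ((RCLike.re z : ℝ) : 𝕜) = z := by
  obtain ⟨h, e⟩ := hx
  have h1 := inner_apply_comm hA ⟨x, h⟩ ⟨x, h⟩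
  rw [e, inner_smul_left, inner_smul_right] at h1
  exact RCLike.conj_eq_iff_re.1 (mul_right_cancel₀ (inner_self_ne_zero.2 hx0) h1)

theorem orthogonalFamily_eigenspace (hA : IsSelfAdjoint A) :
    OrthogonalFamily 𝕜 (fun l : ℝ => eigenspace A (l : 𝕜))
      (fun l : ℝ => (eigenspace A (l : 𝕜)).subtypeₗᵢ) := by
  rintro l m hlm ⟨x, hx, ex⟩ ⟨y, hy, ey⟩
  have h1 := inner_apply_comm hA ⟨x, hx⟩ ⟨y, hy⟩
  rw [ex, ey, inner_smul_left, inner_smul_right, RCLike.conj_ofReal] at h1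
  by_contra h0
  exact hlm (RCLike.ofReal_injective (mul_right_cancel₀ h0 h1))

theorem isSymmetric_resolvent {μ : ℝ} {R : H →L[𝕜] H} (hA : IsSelfAdjoint A)
    (hR : ∀ y : H, ∃ h : R y ∈ A.domain, (μ : 𝕜) • R y - A ⟨R y, h⟩ = y) :
    (R : H →ₗ[𝕜] H).IsSymmetric := by
  intro x y
  obtain ⟨hx, ex⟩ := hR x
  obtain ⟨hy, ey⟩ := hR y
  have h := inner_apply_comm hA ⟨R x, hx⟩ ⟨R y, hy⟩
  simp only at h
  simp only [ContinuousLinearMap.coe_coe]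
  nth_rw 2 [← ex]
  nth_rw 1 [← ey]
  rw [inner_sub_left, inner_sub_right, inner_smul_left, inner_smul_right, RCLike.conj_ofReal, h]

/-- The eigenvectors of a self-adjoint operator with discrete spectrum are total. -/
theorem orthogonal_iSup_eigenspace_eq_bot (hA : IsSelfAdjoint A)
    (hσ : HasDiscreteSpectrumToNegInfty A) : (⨆ l : ℝ, eigenspace A (l : 𝕜))ᗮ = ⊥ := by
  obtain ⟨μ, -, R, hR₁, hR₂⟩ := exists_resolvent_real hσ
  have hsym := isSymmetric_resolvent hA hR₁
  set M := (⨆ l : ℝ, eigenspace A (l : 𝕜))ᗮ with hM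
  have hmem : ∀ x, x ∈ M ↔ ∀ (l : ℝ), ∀ v ∈ eigenspace A (l : 𝕜), inner 𝕜 v x = 0 := by
    intro x
    rw [hM, ← Submodule.iInf_orthogonal, Submodule.mem_iInf]
    simp only [Submodule.mem_orthogonal]
  have hinv : ∀ x ∈ M, R x ∈ M := by
    intro x hx
    rw [hmem] at hx ⊢
    intro l v hv
    have h1 := smul_resolvent_apply_of_mem_eigenspace hR₂ hv
    have h2 : inner 𝕜 v (R x) = inner 𝕜 (R v) x := (hsym v x).symm
    rw [h2]
    by_cases h0 : (μ : 𝕜) - l = 0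
    · rw [h0, zero_smul] at h1
      rw [← h1, map_zero, inner_zero_left]
    · rw [← inv_smul_smul₀ h0 (R v), h1, inner_smul_left, hx l v hv, mul_zero]
  let T : M →L[𝕜] M := (R.comp M.subtypeL).codRestrict M (fun x => hinv x x.2)
  have hT : ∀ x : M, ((T x : M) : H) = R x := fun _ => rfl
  have hT0 : T = 0 := by
    refine eq_zero_of_isolated_of_no_eigenvalue (fun x y => hsym x y) (fun r hr => ?_)
      (fun r hr x hx => ?_)
    -- Lower bounds pass to an invariant subspace at once, unlike surjectivity.
    · filter_upwards [eventually_boundedBelow_shift_resolvent hσ hR₁ hr] with z hz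
      obtain ⟨c, hc, h⟩ := hz
      exact ⟨c, hc, fun x => h x⟩
    · have h1 : R x = (r : 𝕜) • (x : H) := by rw [← hT, hx]; rfl
      have h2 := (hmem x).1 x.2 _ _ (mem_eigenspace_of_resolvent_eq hR₁ hr h1)
      exact Subtype.ext (inner_self_eq_zero.1 h2)
  rw [eq_bot_iff]
  intro x hx
  have h1 : R x = 0 := by rw [← hT ⟨x, hx⟩, hT0]; rfl
  obtain ⟨h, e⟩ := hR₁ x
  have h2 : (⟨R x, h⟩ : A.domain) = 0 := Subtype.ext h1
  rw [h2, A.map_zero, h1, smul_zero, sub_zero] at e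
  simpa using e.symm

/-- The expansion of a vector with respect to the eigenspaces. -/
theorem exists_hasSum_eigenspace (hA : IsSelfAdjoint A) (hσ : HasDiscreteSpectrumToNegInfty A)
    (x : H) : ∃ p : ℝ → H, (∀ l : ℝ, p l ∈ eigenspace A (l : 𝕜)) ∧ HasSum p x ∧
      Summable fun l => ‖p l‖ ^ 2 := by
  have hfd : ∀ l : ℝ, FiniteDimensional 𝕜 (eigenspace A (l : 𝕜)) := by
    intro l
    by_cases hl : (l : 𝕜) ∈ spectrum A
    · exact hσ.finite_multiplicity _ hl
    · have : eigenspace A (l : 𝕜) = ⊥ := by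
        rw [eq_bot_iff]
        intro v hv
        by_contra hv0
        exact hl (mem_spectrum_of_mem_eigenspace hv hv0)
      rw [this]
      infer_instance
  have hc : ∀ l : ℝ, CompleteSpace (eigenspace A (l : 𝕜)) := fun l =>
    FiniteDimensional.complete 𝕜 _
  have hO := orthogonalFamily_eigenspace hA
  have hS := IsHilbertSum.mkInternal (fun l : ℝ => eigenspace A (l : 𝕜)) hO
    (Submodule.topologicalClosure_eq_top_iff.2 (orthogonal_iSup_eigenspace_eq_bot hA hσ)).ge
  have hsum := hS.hasSum_linearIsometryEquiv_symm (hS.linearIsometryEquiv x)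
  rw [LinearIsometryEquiv.symm_apply_apply] at hsum
  exact ⟨fun l => (hS.linearIsometryEquiv x l : eigenspace A (l : 𝕜)), fun l => Subtype.mem _,
    hsum, (hO.summable_iff_norm_sq_summable _).1 hsum.summable⟩

end Spectral

/-! ### The semigroup on eigenvectors -/

section Semigroup

variable {𝕜 : Type*} [RCLike 𝕜]
variable {H : Type*} [NormedAddCommGroup H] [InnerProductSpace 𝕜 H]
  [NormedSpace ℝ H] [IsScalarTower ℝ 𝕜 H]
variable {A : H →ₗ.[𝕜] H} {S : ℝ → H →L[𝕜] H}

/-- The semigroup acts on eigenvectors of its generator by exponentials. -/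
theorem semigroup_apply_of_mem_eigenspace (hS : IsC0Semigroup S) (hSA : IsGenerator A S)
    {l : ℝ} {v : H} (hv : v ∈ eigenspace A (l : 𝕜)) {t : ℝ} (ht : 0 ≤ t) :
    S t v = ((Real.exp (l * t) : ℝ) : 𝕜) • v := by
  have hgen := (hSA v ((l : 𝕜) • v)).1 hv
  -- The right derivative suffices: it follows from the generator limit at 0, and a continuous
  -- function with zero right derivative is constant.
  have hderiv : ∀ s, 0 ≤ s → HasDerivWithinAt (fun s => S s v) (l • S s v) (Ici s) s := by
    intro s hs
    rw [← hasDerivWithinAt_Ioi_iff_Ici, hasDerivWithinAt_iff_tendsto_slope' (by simp)]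
    have h1 : Tendsto (fun τ : ℝ => τ - s) (𝓝[>] s) (𝓝[>] 0) := by
      refine tendsto_nhdsWithin_iff.2 ⟨?_, ?_⟩
      · have : ContinuousAt (fun τ : ℝ => τ - s) s := by fun_prop
        simpa [ContinuousAt] using this.tendsto.mono_left nhdsWithin_le_nhds
      · filter_upwards [self_mem_nhdsWithin] with τ hτ
        simpa using hτ
    have h2 := ((S s).continuous.tendsto _).comp (hgen.comp h1)
    have h3 : S s ((l : 𝕜) • v) = l • S s v := by
      rw [map_smul, RCLike.real_smul_eq_coe_smul (K := 𝕜)]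
    rw [h3] at h2
    refine h2.congr' ?_
    filter_upwards [self_mem_nhdsWithin] with τ hτ
    have hτ' : s < τ := hτ
    have h4 : S τ v = S s (S (τ - s) v) := by
      rw [← ContinuousLinearMap.comp_apply, ← hS.map_add s (τ - s) hs (by linarith)]
      congr 2
      ring
    simp only [Function.comp_apply, slope, vsub_eq_sub, h4, map_smul, map_sub]
    rw [RCLike.real_smul_eq_coe_smul (K := 𝕜), RCLike.ofReal_inv, RCLike.ofReal_sub]
  have hconst := constant_of_has_deriv_right_zero (a := 0) (b := t)
    (f := fun s => Real.exp (-(l * s)) • S s v)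
    ((by fun_prop : Continuous fun s => Real.exp (-(l * s))).continuousOn.smul
      ((hS.continuousOn v).mono Icc_subset_Ici_self))
    (fun s hs => by
      have he : HasDerivWithinAt (fun s => Real.exp (-(l * s))) (Real.exp (-(l * s)) * (-(l * 1)))
          (Ici s) s := (((hasDerivAt_id s).const_mul l).neg.exp).hasDerivWithinAt
      have := he.smul (hderiv s hs.1)
      have e0 : Real.exp (-(l * s)) • l • S s v + (Real.exp (-(l * s)) * -(l * 1)) • S s v = 0 := by
        module
      rwa [e0] at this) t ⟨ht, le_rfl⟩
  simp only [mul_zero, neg_zero, Real.exp_zero, one_smul, hS.map_zero,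
    ContinuousLinearMap.id_apply] at hconst
  rw [← RCLike.real_smul_eq_coe_smul (K := 𝕜)]
  calc S t v = (Real.exp (l * t) * Real.exp (-(l * t))) • S t v := by
        rw [← Real.exp_add, add_neg_cancel, Real.exp_zero, one_smul]
    _ = _ := by rw [mul_smul, hconst]

end Semigroup

/-! ### Large-time asymptotics of orbits -/

section Dominant

variable {𝕜 : Type*} [RCLike 𝕜]
variable {H : Type*} [NormedAddCommGroup H] [InnerProductSpace 𝕜 H] [CompleteSpace H]
variable {A : H →ₗ.[𝕜] H}

theorem inner_eq_inner_component (hA : IsSelfAdjoint A) {p : ℝ → H} {x : H}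
    (hp : ∀ l : ℝ, p l ∈ eigenspace A (l : 𝕜)) (hx : HasSum p x) {l : ℝ} {y : H}
    (hy : y ∈ eigenspace A (l : 𝕜)) : inner 𝕜 y x = inner 𝕜 y (p l) := by
  refine (hx.mapL (innerSL 𝕜 y)).unique (hasSum_single l fun m hm => ?_)
  exact orthogonalFamily_eigenspace hA hm.symm ⟨y, hy⟩ ⟨p m, hp m⟩

variable [NormedSpace ℝ H] [IsScalarTower ℝ 𝕜 H] {S : ℝ → H →L[𝕜] H}

theorem hasSum_inner_semigroup (hA : IsSelfAdjoint A) (hS : IsC0Semigroup S)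
    (hSA : IsGenerator A S) {p q : ℝ → H} {x y : H}
    (hp : ∀ l : ℝ, p l ∈ eigenspace A (l : 𝕜)) (hx : HasSum p x)
    (hq : ∀ l : ℝ, q l ∈ eigenspace A (l : 𝕜)) (hy : HasSum q y) {t : ℝ} (ht : 0 ≤ t) :
    HasSum (fun l : ℝ => ((Real.exp (l * t) : ℝ) : 𝕜) * inner 𝕜 (p l) (q l))
      (inner 𝕜 x (S t y)) := by
  convert (hy.mapL (S t)).mapL (innerSL 𝕜 x) using 2 with l
  rw [innerSL_apply_apply, semigroup_apply_of_mem_eigenspace hS hSA (hq l) ht, inner_smul_right,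
    ← inner_conj_symm x, inner_eq_inner_component hA hp hx (hq l), inner_conj_symm]
  rfl

theorem inner_semigroup_of_mem_eigenspace (hA : IsSelfAdjoint A)
    (hσ : HasDiscreteSpectrumToNegInfty A) (hS : IsC0Semigroup S) (hSA : IsGenerator A S)
    {l : ℝ} {x : H} (hx : x ∈ eigenspace A (l : 𝕜)) (y : H) {t : ℝ} (ht : 0 ≤ t) :
    inner 𝕜 x (S t y) = ((Real.exp (l * t) : ℝ) : 𝕜) * inner 𝕜 x y := by
  obtain ⟨q, hq, hy, -⟩ := exists_hasSum_eigenspace hA hσ y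
  have hmem : ∀ m : ℝ, S t (q m) ∈ eigenspace A (m : 𝕜) := fun m => by
    rw [semigroup_apply_of_mem_eigenspace hS hSA (hq m) ht]
    exact Submodule.smul_mem _ _ (hq m)
  rw [inner_eq_inner_component hA hmem (hy.mapL (S t)) hx, inner_eq_inner_component hA hq hy hx,
    semigroup_apply_of_mem_eigenspace hS hSA (hq l) ht, inner_smul_right]

/-- The adjoint orbit of a nonzero vector is asymptotically dominated by an eigenvector. -/
theorem exists_dominant_eigenvector (hA : IsSelfAdjoint A)
    (hσ : HasDiscreteSpectrumToNegInfty A) (hS : IsC0Semigroup S) (hSA : IsGenerator A S)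
    {x : H} (hx0 : x ≠ 0) : ∃ (l : ℝ) (v : H), v ∈ eigenspace A (l : 𝕜) ∧ v ≠ 0 ∧
      ∀ y, Tendsto (fun t : ℝ => ((Real.exp (-(l * t)) : ℝ) : 𝕜) * inner 𝕜 x (S t y)) atTop
        (𝓝 (inner 𝕜 v y)) := by
  obtain ⟨p, hp, hx, hpsum⟩ := exists_hasSum_eigenspace hA hσ x
  obtain ⟨l₁, hl₁⟩ : ∃ l, p l ≠ 0 := by
    by_contra! h
    rw [show p = fun _ => 0 from funext h] at hx
    exact hx0 (hx.unique hasSum_zero)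
  -- The spectrum tends to `-∞`, so a largest exponent with nonzero component exists.
  have hfin : {l : ℝ | p l ≠ 0 ∧ l₁ ≤ l}.Finite := by
    refine ((hσ.finite_re_ge l₁).preimage
      (RCLike.ofReal_injective (K := 𝕜)).injOn).subset fun l hl => ?_
    exact ⟨mem_spectrum_of_mem_eigenspace (hp l) hl.1, by rw [RCLike.ofReal_re]; exact hl.2⟩
  obtain ⟨l₀, ⟨hl₀, hl₁₀⟩, hmax⟩ := hfin.exists_maximalFor id _ ⟨l₁, hl₁, le_rfl⟩
  have hle : ∀ l, p l ≠ 0 → l ≤ l₀ := by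
    intro l hl
    by_contra! hlt
    exact absurd (hmax ⟨hl, hl₁₀.trans hlt.le⟩ hlt.le) (not_le.2 hlt)
  refine ⟨l₀, p l₀, hp l₀, hl₀, fun y => ?_⟩
  obtain ⟨q, hq, hy, hqsum⟩ := exists_hasSum_eigenspace hA hσ y
  have hbound : Summable fun l => ‖p l‖ * ‖q l‖ := by
    refine Summable.of_nonneg_of_le (fun _ => by positivity) (fun l => ?_) (hpsum.add hqsum)
    nlinarith [sq_nonneg (‖p l‖ - ‖q l‖), sq_nonneg (‖p l‖ + ‖q l‖)]
  -- Where `p l ≠ 0` the exponent `(l - l₀)t` is nonpositive, so `‖p l‖‖q l‖` dominates uniformly in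
  -- `t ≥ 0`; only the term `l₀` survives.
  have hlim := tendsto_tsum_of_dominated_convergence (𝓕 := atTop)
    (f := fun (t l : ℝ) => ((Real.exp ((l - l₀) * t) : ℝ) : 𝕜) * inner 𝕜 (p l) (q l))
    (g := fun l => if l = l₀ then inner 𝕜 (p l₀) (q l₀) else 0) hbound
    (fun l => by
      by_cases h0 : p l = 0
      · have hne : l ≠ l₀ := by rintro rfl; exact hl₀ h0
        simp [h0, hne]
      rcases (hle l h0).eq_or_lt with rfl | hlt
      · simp
      · have h1 : Tendsto (fun t : ℝ => (l - l₀) * t) atTop atBot :=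
          tendsto_id.const_mul_atTop_of_neg (by linarith)
        have h2 := ((RCLike.continuous_ofReal (K := 𝕜)).tendsto 0).comp
          (Real.tendsto_exp_atBot.comp h1)
        simpa [hlt.ne] using h2.mul_const (inner 𝕜 (p l) (q l)))
    (by
      filter_upwards [eventually_ge_atTop 0] with t ht l
      rw [norm_mul, RCLike.norm_ofReal, Real.abs_exp]
      by_cases h0 : p l = 0
      · simp [h0]
      have h1 : Real.exp ((l - l₀) * t) ≤ 1 :=
        Real.exp_le_one_iff.2 (mul_nonpos_of_nonpos_of_nonneg (by linarith [hle l h0]) ht)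
      calc _ ≤ 1 * (‖p l‖ * ‖q l‖) := by
            gcongr
            exact norm_inner_le_norm _ _
        _ = _ := one_mul _)
  rw [tsum_ite_eq, ← inner_eq_inner_component hA hq hy (hp l₀)] at hlim
  refine hlim.congr' ?_
  filter_upwards [eventually_ge_atTop 0] with t ht
  have h1 := (hasSum_inner_semigroup hA hS hSA hp hx hq hy ht).mul_left
    ((Real.exp (-(l₀ * t)) : ℝ) : 𝕜)
  rw [← h1.tsum_eq]
  congr 1
  ext l
  rw [← mul_assoc, ← RCLike.ofReal_mul, ← Real.exp_add]
  congr 3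
  ring

end Dominant

/-! ### Reachable states and separation -/

section Control

variable {𝕜 : Type*} [RCLike 𝕜]
variable {H : Type*} [NormedAddCommGroup H] [InnerProductSpace 𝕜 H]
  [NormedSpace ℝ H]
variable {U : Type*} [NormedAddCommGroup U] [NormedSpace 𝕜 U] [NormedSpace ℝ U]

/-- The states `∫₀^∞ S(τ) B v(τ) dτ` for continuous compactly supported `v` with values in
the cone `Ω`. -/
def continuousEndpoints (S : ℝ → H →L[𝕜] H) (B : U →L[𝕜] H) (Ω : ProperCone ℝ U) : Set H :=
  {x | ∃ v : ℝ → U, Continuous v ∧ HasCompactSupport v ∧ (∀ τ, v τ ∈ Ω) ∧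
    IntegrableOn (fun τ => S τ (B (v τ))) (Ioi 0) ∧ ∫ τ in Ioi (0 : ℝ), S τ (B (v τ)) = x}

variable {S : ℝ → H →L[𝕜] H} {B : U →L[𝕜] H} {Ω : ProperCone ℝ U}

theorem zero_mem_continuousEndpoints : (0 : H) ∈ continuousEndpoints S B Ω :=
  ⟨fun _ => 0, continuous_const, HasCompactSupport.zero, fun _ => Ω.zero_mem, by simp, by simp⟩

theorem smul_add_smul_mem_continuousEndpoints [IsScalarTower ℝ 𝕜 H] [IsScalarTower ℝ 𝕜 U]
    {x y : H} (hx : x ∈ continuousEndpoints S B Ω)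
    (hy : y ∈ continuousEndpoints S B Ω) {a b : ℝ} (ha : 0 ≤ a) (hb : 0 ≤ b) :
    a • x + b • y ∈ continuousEndpoints S B Ω := by
  obtain ⟨v, hv, hvs, hvΩ, hvi, rfl⟩ := hx
  obtain ⟨w, hw, hws, hwΩ, hwi, rfl⟩ := hy
  have key : (fun τ => S τ (B (a • v τ + b • w τ))) =
      fun τ => a • S τ (B (v τ)) + b • S τ (B (w τ)) := by
    ext τ
    simp only [map_add, ContinuousLinearMap.map_smul_of_tower]
  refine ⟨fun τ => a • v τ + b • w τ, by fun_prop, ?_, fun τ => ?_, ?_, ?_⟩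
  · exact (hvs.smul_left (f := fun _ => a)).add (hws.smul_left (f := fun _ => b))
  · exact Ω.add_mem (Ω.smul_mem (hvΩ τ) ha)
      (Ω.smul_mem (hwΩ τ) hb)
  · rw [key]
    exact (hvi.smul a).add (hwi.smul b)
  · rw [key, ← integral_smul, ← integral_smul]
    exact integral_add (hvi.smul a) (hwi.smul b)

/-- Reversing time on `[0, T]`, with `T` beyond the support of `v`, turns the half-line integral
into a solution. The half-line form has no final time, which makes the endpoints a convex cone. -/
theorem exists_solution_eq_of_mem_continuousEndpoints {x : H}
    (hx : x ∈ continuousEndpoints S B Ω) :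
    ∃ u : ℝ → U, IsAdmissible Ω u ∧ ∃ t : ℝ, 0 < t ∧ solution S B 0 u t = x := by
  obtain ⟨v, hv, hvs, hvΩ, -, rfl⟩ := hx
  obtain ⟨T, hT0, hT⟩ : ∃ T : ℝ, 0 < T ∧ ∀ τ, T < τ → v τ = 0 := by
    obtain ⟨b, hb⟩ := hvs.isCompact.bddAbove
    refine ⟨max b 1, by positivity, fun τ hτ => image_eq_zero_of_notMem_tsupport fun h => ?_⟩
    exact absurd (hb h) (not_le.2 ((le_max_left _ _).trans_lt hτ))
  refine ⟨fun τ => v (T - τ), ⟨fun T' => ?_, ?_⟩, T, hT0, ?_⟩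
  · have hc : HasCompactSupport fun τ => v (T - τ) :=
      hvs.comp_homeomorph (Homeomorph.subLeft T)
    exact Continuous.memLp_of_hasCompactSupport (by fun_prop) hc
  · exact Eventually.of_forall fun τ => hvΩ _
  · rw [solution, map_zero, zero_add,
      intervalIntegral.integral_comp_sub_left (fun τ => S τ (B (v τ))) T, sub_self, sub_zero,
      intervalIntegral.integral_of_le hT0.le]
    refine (setIntegral_eq_of_subset_of_forall_sdiff_eq_zero measurableSet_Ioi
      Ioc_subset_Ioi_self fun τ hτ => ?_).symm
    rw [hT τ (not_le.1 fun h => hτ.2 ⟨hτ.1, h⟩), map_zero, map_zero]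

theorem bump_smul_endpoint_mem [IsScalarTower ℝ 𝕜 H] [IsScalarTower ℝ 𝕜 U]
    (hS : IsC0Semigroup S) {u : U} (hu : u ∈ Ω) {c : ℝ → ℝ}
    (hc : Continuous c) (hcs : HasCompactSupport c) (hc0 : ∀ τ, 0 ≤ c τ) :
    IntegrableOn (fun τ => c τ • S τ (B u)) (Ioi 0) ∧
      ∫ τ in Ioi (0 : ℝ), c τ • S τ (B u) ∈ continuousEndpoints S B Ω := by
  have hint : IntegrableOn (fun τ => c τ • S τ (B u)) (Ioi 0) := by
    have h1 : IntegrableOn (fun τ => c τ • S τ (B u)) (tsupport c ∩ Ici 0) :=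
      ContinuousOn.integrableOn_compact (hcs.isCompact.inter_right isClosed_Ici)
        (hc.continuousOn.smul ((hS.continuousOn (B u)).mono inter_subset_right))
    refine h1.of_forall_sdiff_eq_zero measurableSet_Ioi fun τ hτ => ?_
    have : c τ = 0 := image_eq_zero_of_notMem_tsupport fun h =>
      hτ.2 ⟨h, le_of_lt (show (0 : ℝ) < τ from hτ.1)⟩
    rw [this, zero_smul]
  have key : (fun τ => S τ (B (c τ • u))) = fun τ => c τ • S τ (B u) := by
    ext τ
    simp only [ContinuousLinearMap.map_smul_of_tower]
  refine ⟨hint, fun τ => c τ • u, by fun_prop, hcs.smul_right,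
    fun τ => Ω.smul_mem hu (hc0 τ), ?_, ?_⟩
  · rw [key]
    exact hint
  · rw [key]

variable (𝕜) in
/-- The real linear functional `x ↦ Re ⟪φ, x⟫`. -/
def reInner [IsScalarTower ℝ 𝕜 H] (φ : H) : H →L[ℝ] ℝ :=
  RCLike.reCLM.comp ((innerSL 𝕜 φ).restrictScalars ℝ)

theorem reInner_apply [IsScalarTower ℝ 𝕜 H] (φ x : H) :
    reInner 𝕜 φ x = RCLike.re (inner 𝕜 φ x) := rfl

/-- A functional that is nonpositive on the endpoints is nonpositive along all orbits that start
in `B Ω`. -/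
theorem re_inner_semigroup_nonpos [CompleteSpace H] [IsScalarTower ℝ 𝕜 H] [IsScalarTower ℝ 𝕜 U]
    (hS : IsC0Semigroup S) {φ : H}
    (hφ : ∀ x ∈ continuousEndpoints S B Ω, RCLike.re (inner 𝕜 φ x) ≤ 0) {u : U} (hu : u ∈ Ω)
    {t : ℝ} (ht : 0 < t) : RCLike.re (inner 𝕜 φ (S t (B u))) ≤ 0 := by
  by_contra! hpos
  have hcont : ContinuousAt (fun s => reInner 𝕜 φ (S s (B u))) t :=
    (reInner 𝕜 φ).continuous.continuousAt.comp
      ((hS.continuousOn (B u)).continuousAt (Ici_mem_nhds ht))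
  obtain ⟨h, hh, hball⟩ := Metric.eventually_nhds_iff_ball.1
    ((hcont.eventually (lt_mem_nhds (show 0 < reInner 𝕜 φ (S t (B u)) from hpos))).and
      (lt_mem_nhds ht))
  -- A control `c(τ)u` concentrated where the integrand is positive would give an endpoint with
  -- positive functional value.
  let c : ContDiffBump t := ⟨h / 2, h, by positivity, by linarith⟩
  obtain ⟨hint, hmem⟩ := bump_smul_endpoint_mem (B := B) hS hu c.continuous c.hasCompactSupport
    (fun τ => c.nonneg)
  have h1 := hφ _ hmem
  rw [← reInner_apply, ← ContinuousLinearMap.integral_comp_comm _ hint] at h1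
  refine absurd h1 (not_le.2 ?_)
  rw [setIntegral_pos_iff_support_of_nonneg_ae _ ((reInner 𝕜 φ).integrable_comp hint)]
  · refine (Metric.measure_ball_pos volume t hh).trans_le (measure_mono fun s hs => ?_)
    refine ⟨?_, (hball s hs).2⟩
    rw [Function.mem_support, map_smul, smul_eq_mul]
    exact (mul_pos (c.pos_of_mem_ball hs) (hball s hs).1).ne'
  · refine Eventually.of_forall fun s => ?_
    simp only [Pi.zero_apply, map_smul, smul_eq_mul]
    by_cases hs : s ∈ Metric.ball t h
    · exact mul_nonneg c.nonneg (hball s hs).1.le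
    · have : c s = 0 := c.zero_of_le_dist (by simpa using hs)
      simp [this]

theorem re_inner_solution_nonpos [CompleteSpace H] [IsScalarTower ℝ 𝕜 H] {φ : H}
    (hφ : ∀ s, 0 ≤ s → ∀ u ∈ Ω, RCLike.re (inner 𝕜 φ (S s (B u))) ≤ 0) {u : ℝ → U}
    (hu : IsAdmissible Ω u) {t : ℝ} (ht : 0 < t) :
    RCLike.re (inner 𝕜 φ (solution S B 0 u t)) ≤ 0 := by
  rw [solution, map_zero, zero_add, intervalIntegral.integral_of_le ht.le]
  by_cases hint : IntegrableOn (fun τ => S (t - τ) (B (u τ))) (Ioc 0 t)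
  · rw [← reInner_apply, ← ContinuousLinearMap.integral_comp_comm _ hint]
    refine integral_nonpos_of_ae ?_
    have h1 : ∀ᵐ τ ∂(volume.restrict (Ioc 0 t)), u τ ∈ Ω :=
      ae_restrict_of_ae_restrict_of_subset (fun τ hτ => hτ.1.le) hu.mem
    filter_upwards [h1, ae_restrict_mem measurableSet_Ioc] with τ hτ hτt
    exact hφ _ (by linarith [hτt.2]) _ hτ
  -- The integral takes its default value 0 here.
  · rw [integral_undef hint]
    simp

/-- The state `φ` itself is out of reach: `Re ⟪φ, x⟫ ≤ 0` forces `‖φ - x‖ ≥ ‖φ‖`. -/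
theorem not_approxControllable_of_re_inner_nonpos [CompleteSpace H] [IsScalarTower ℝ 𝕜 H]
    {φ : H} (hφ0 : φ ≠ 0)
    (hφ : ∀ s, 0 ≤ s → ∀ u ∈ Ω, RCLike.re (inner 𝕜 φ (S s (B u))) ≤ 0) :
    ¬ ApproxControllable S B Ω := by
  intro hc
  obtain ⟨u, hu, t, ht, hlt⟩ := hc φ ‖φ‖ (norm_pos_iff.2 hφ0)
  have h1 := re_inner_solution_nonpos hφ hu ht
  have h2 : ‖φ - solution S B 0 u t‖ ^ 2 < ‖φ‖ ^ 2 := by gcongr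
  rw [@norm_sub_sq 𝕜] at h2
  nlinarith [sq_nonneg ‖solution S B 0 u t‖]

/-- A system that is not approximately controllable has a nonzero functional that is nonpositive
along all orbits that start in `B Ω`. -/
theorem exists_re_inner_nonpos_of_not_approxControllable [CompleteSpace H] [IsScalarTower ℝ 𝕜 H]
    [IsScalarTower ℝ 𝕜 U] (hS : IsC0Semigroup S) (h : ¬ ApproxControllable S B Ω) :
    ∃ φ : H, φ ≠ 0 ∧ ∀ t, 0 < t → ∀ u ∈ Ω, RCLike.re (inner 𝕜 φ (S t (B u))) ≤ 0 := by
  simp only [ApproxControllable, not_forall] at h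
  obtain ⟨x₁, ε, hε, hx₁⟩ := h
  set K := continuousEndpoints S B Ω with hK
  have hconv : Convex ℝ K := fun x hx y hy a b ha hb _ =>
    smul_add_smul_mem_continuousEndpoints hx hy ha hb
  have hnot : x₁ ∉ closure K := by
    intro hmem
    obtain ⟨x, hx, hdist⟩ := Metric.mem_closure_iff.1 hmem ε hε
    obtain ⟨u, hu, t, ht, rfl⟩ := exists_solution_eq_of_mem_continuousEndpoints hx
    exact hx₁ ⟨u, hu, t, ht, by rwa [← dist_eq_norm]⟩
  obtain ⟨f, r, hf, hr⟩ := RCLike.geometric_hahn_banach_closed_point (𝕜 := 𝕜) hconv.closure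
    isClosed_closure hnot
  obtain ⟨φ, rfl⟩ := (InnerProductSpace.toDual 𝕜 H).surjective f
  simp only [InnerProductSpace.toDual_apply_apply] at hf hr
  have hr0 : 0 < r := by simpa using hf 0 (subset_closure zero_mem_continuousEndpoints)
  refine ⟨φ, ?_, fun t ht u hu => re_inner_semigroup_nonpos hS (fun x hx => ?_) hu ht⟩
  · rintro rfl
    simp only [inner_zero_left, map_zero] at hr
    linarith
  -- A functional bounded above on a cone is nonpositive there: the multiple `(r / g) • x` would
  -- attain the excluded value `r`.
  · by_contra! hpos
    set g := RCLike.re (inner 𝕜 φ x) with hg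
    have h1 := hf _ (subset_closure (smul_add_smul_mem_continuousEndpoints hx hx
      (a := r / g) (b := 0) (by positivity) le_rfl))
    rw [zero_smul, add_zero, ← reInner_apply, map_smul, reInner_apply, smul_eq_mul, ← hg,
      div_mul_cancel₀ _ hpos.ne'] at h1
    exact lt_irrefl _ h1

end Control

end OmegaControl

end

/-! ### The controllability criterion -/

theorem theorem3 {𝕜 : Type*} [RCLike 𝕜]
    {H : Type*} [NormedAddCommGroup H] [InnerProductSpace 𝕜 H] [CompleteSpace H]
    [NormedSpace ℝ H] [IsScalarTower ℝ 𝕜 H]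
    {U : Type*} [NormedAddCommGroup U] [NormedSpace 𝕜 U] [CompleteSpace U]
    [NormedSpace ℝ U] [IsScalarTower ℝ 𝕜 U]
    (A : H →ₗ.[𝕜] H) (hA : IsSelfAdjoint A)
    (hσ : OmegaControl.HasDiscreteSpectrumToNegInfty A)
    (S : ℝ → H →L[𝕜] H) (hS : OmegaControl.IsC0Semigroup S)
    (hSA : OmegaControl.IsGenerator A S)
    (B : U →L[𝕜] H) (Ω : ProperCone ℝ U) :
    OmegaControl.ApproxControllable S B Ω ↔
      (∀ z ∈ OmegaControl.spectrum A,
        OmegaControl.eigenspace A z ⊓ (OmegaControl.adj B).toLinearMap.ker = ⊥) ∧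
      ¬ ∃ (z : 𝕜) (φ : H), φ ∈ OmegaControl.eigenspace A z ∧ φ ≠ 0 ∧
        OmegaControl.LeOn Ω (OmegaControl.adj B φ) 0 := by
  constructor
  · intro hc
    have h2 : ¬ ∃ (z : 𝕜) (φ : H), φ ∈ OmegaControl.eigenspace A z ∧ φ ≠ 0 ∧
        OmegaControl.LeOn Ω (OmegaControl.adj B φ) 0 := by
      rintro ⟨z, φ, hφ, hφ0, hle⟩
      rw [← OmegaControl.ofReal_re_eq_of_mem_eigenspace hA hφ hφ0] at hφ
      refine OmegaControl.not_approxControllable_of_re_inner_nonpos hφ0 (fun s hs u hu => ?_) hc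
      rw [OmegaControl.inner_semigroup_of_mem_eigenspace hA hσ hS hSA hφ _ hs,
        RCLike.re_ofReal_mul]
      have h1 : RCLike.re (inner 𝕜 φ (B u)) ≤ 0 := by
        simpa [OmegaControl.adj_apply] using hle u hu
      exact mul_nonpos_of_nonneg_of_nonpos (Real.exp_pos _).le h1
    -- An eigenvector in `Ker B*` satisfies `B*φ = 0 ≤ 0`, so (2) already excludes it.
    refine ⟨fun z _ => ?_, h2⟩
    rw [eq_bot_iff]
    rintro φ ⟨hφ, hker⟩
    by_contra hφ0
    refine h2 ⟨z, φ, hφ, hφ0, fun u _ => ?_⟩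
    have h1 : OmegaControl.adj B φ = 0 := hker
    rw [h1]
  · rintro ⟨-, h2⟩
    by_contra hc
    obtain ⟨φ, hφ0, hφ⟩ := OmegaControl.exists_re_inner_nonpos_of_not_approxControllable hS hc
    obtain ⟨l, v, hv, hv0, hlim⟩ := OmegaControl.exists_dominant_eigenvector hA hσ hS hSA hφ0
    refine h2 ⟨l, v, hv, hv0, fun u hu => ?_⟩
    rw [OmegaControl.adj_apply, zero_apply, map_zero]
    refine le_of_tendsto ((RCLike.continuous_re.tendsto _).comp (hlim (B u))) ?_
    filter_upwards [eventually_gt_atTop 0] with t ht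
    rw [Function.comp_apply, RCLike.re_ofReal_mul]
    exact mul_nonpos_of_nonneg_of_nonpos (Real.exp_pos _).le (hφ t ht u hu)
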